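/- Let $p$ be a prime number and let $(R,\mathfrak m)$ be a Noetherian local ring of characteristic $p$. For an ideal $\mathfrak a$ of $R$ and a positive integer $e$, let $\mathfrak a^{[p^e]}$ be the ideal generated by $\{a^{p^e}\mid a\in\mathfrak a\}$, and let $l$ denote the length of a module. For an $\mathfrak m$-primary ideal $I_0$ of $R$ and an ideal $I$ properly containing $I_0$, put $$s^e_{I_0}(R,I)=\frac{l\bigl(I^{[p^e]}/I_0^{[p^e]}\bigr)}{p^{e\dim R}\,l(I/I_0)},\qquad \mathcal S^e_{I_0}(R)=\{\,s^e_{I_0}(R,I)\mid \mathfrak m I\subseteq I_0\subsetneq I\,\},\qquad s^e_{I_0}(R)=\min \mathcal S^e_{I_0}(R).$$ Let $(R,\mathfrak m)\to(S,\mathfrak n)$ be an étale-local map of Noetherian local rings of characteristic $p$, that is, a local map of local rings that is a localization of an étale ring map, and let $I_0$ be an $\mathfrak m$-primary ideal of $R$. Then for every positive integer $e$, the minima $s^e_{I_0}(R)$ and $s^e_{I_0S}(S)$ are attained, and $$s^e_{I_0}(R)=s^e_{I_0S}(S).$$ -/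

import Mathlib

universe u v

/-- The ideal `I^{[p^e]}` generated by the `p^e`-th powers of the elements of `I`. -/
def frobPower {R : Type u} [CommRing R] (p e : ℕ) (I : Ideal R) : Ideal R :=
  Ideal.span {x : R | ∃ a ∈ I, x = a ^ (p ^ e)}

/-- The length `l_R(I / J)` of the quotient module `I / J`, for ideals `J ⊆ I` of `R`
(as a natural number; it is `0` if the length is infinite, which never happens
for ideals of a Noetherian local ring that are primary to the maximal ideal). -/
noncomputable def relLength {R : Type u} [CommRing R] (J I : Ideal R) : ℕ :=
  (Module.length R (I ⧸ J.submoduleOf I)).toNat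

/-- The Krull dimension of `R` as a natural number (finite for a Noetherian local ring). -/
noncomputable def dimNat (R : Type u) [CommRing R] : ℕ :=
  ((ringKrullDim R).unbotD 0).toNat

/-- `s^e_{I₀}(R, I) = l(I^{[p^e]} / I₀^{[p^e]}) / (p^{e dim R} l(I / I₀))`,
for `I` properly containing `I₀`. -/
noncomputable def truncRatio {R : Type u} [CommRing R] (p e : ℕ) (I₀ I : Ideal R) : ℝ :=
  (relLength (frobPower p e I₀) (frobPower p e I) : ℝ) /
    ((p : ℝ) ^ (e * dimNat R) * (relLength I₀ I : ℝ))

/-- The set `𝒮^e_{I₀}(R)` of all `s^e_{I₀}(R, I)` with `𝔪 I ⊆ I₀ ⊊ I`. -/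
def truncSet {R : Type u} [CommRing R] [IsLocalRing R] (p e : ℕ) (I₀ : Ideal R) : Set ℝ :=
  {s : ℝ | ∃ I : Ideal R, IsLocalRing.maximalIdeal R * I ≤ I₀ ∧ I₀ < I ∧
    s = truncRatio p e I₀ I}

/-- The truncated invariant `s^e_{I₀}(R)`, the minimum of `𝒮^e_{I₀}(R)`.
It is written as an infimum of real numbers. -/
noncomputable def truncInv {R : Type u} [CommRing R] [IsLocalRing R]
    (p e : ℕ) (I₀ : Ideal R) : ℝ :=
  sInf (truncSet p e I₀)

/-- An étale-local map of local rings: a local map `R → S` such that `S` is, as an `R`-algebra,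
a localization of an étale `R`-algebra `B`. (An étale algebra is finitely presented, so taking `B`
in the universe of `R` is no restriction.) -/
def IsEtaleLocal (R : Type u) (S : Type v) [CommRing R] [IsLocalRing R]
    [CommRing S] [IsLocalRing S] [Algebra R S] : Prop :=
  IsLocalHom (algebraMap R S) ∧
    ∃ (B : Type u) (_ : CommRing B) (_ : Algebra R B) (_ : Algebra B S)
      (_ : IsScalarTower R B S) (M : Submonoid B),
      Algebra.Etale R B ∧ IsLocalization M S

/-!
An étale-local map `R → S` is flat and extends the maximal ideal to the maximal ideal, so it
preserves the lengths between ideals primary to the maximal ideal (`eLength_map`). Since Frobenius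
powers commute with extension and `dim R = dim S`, extending an ideal from `R` to `S` does not
change its ratio, and the minimum over `S` is at most the minimum over `R`.

The converse is a descent argument in the style of Harder and Narasimhan. On the ideals `J` with
`𝔫J ⊆ I₀ ⊆ J` the length `l(J / I₀)` is modular, while `l(J^[q] / I₀^[q])`, for `q = p ^ e`, is
submodular, because `(J ⊓ K)^[q] ⊆ J^[q] ⊓ K^[q]`. Hence, among the ideals of minimal slope, one of
maximal length contains every other ideal with the same two lengths
(`exists_greatest_of_minimal_slope`), in particular all its images under automorphisms that fix
`I₀` (`exists_stable_minimal_ideal`).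

To have enough automorphisms, enlarge `S` to an étale-local algebra `T` whose residue field is a
finite Galois extension `K` of the residue field of `R`, and set `C = T / 𝔞T` with
`𝔞 = I₀^[q]` (`exists_galois_cover`). The maximal ideal of `C` is nilpotent, so that, `T` being
formally étale over `R`, the Galois group of `K` lifts to automorphisms of `C` over `R`
(`exists_lift_galois`). Galois descent (`map_comap_eq_of_stable`) then shows that the stable ideal
of minimal slope in `C` is extended from `R`. As the slopes of ideals of `R` and of `S` can all be
computed in `C`, its contraction to `R` attains the minimum for `R`, and the extension of this
contraction to `S` attains the minimum for `S`.
-/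

open IsLocalRing

/-! ### Lengths between ideals of a local ring -/

/-- The length of `I / J`, with values in `ℕ∞`, for ideals `J ≤ I` of `R`. -/
noncomputable def eLength {R : Type u} [CommRing R] (J I : Ideal R) : ℕ∞ :=
  Module.length R (I ⧸ J.submoduleOf I)

section Length

variable {R : Type u} [CommRing R]

lemma relLength_eq_toNat (J I : Ideal R) : relLength J I = (eLength J I).toNat := rfl

lemma eLength_self (I : Ideal R) : eLength I I = 0 := by
  rw [eLength, Module.length_eq_zero_iff, Submodule.Quotient.subsingleton_iff,
    Submodule.submoduleOf_self]

lemma eLength_add {J K I : Ideal R} (hJK : J ≤ K) (hKI : K ≤ I) :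
    eLength J I = eLength J K + eLength K I := by
  let i : K →ₗ[R] I := Submodule.inclusion hKI
  have hi : J.submoduleOf K = (J.submoduleOf I).comap i := rfl
  let f : (K ⧸ J.submoduleOf K) →ₗ[R] (I ⧸ J.submoduleOf I) :=
    Submodule.mapQ _ _ i hi.le
  let g : (I ⧸ J.submoduleOf I) →ₗ[R] (I ⧸ K.submoduleOf I) :=
    Submodule.factor (fun x hx => hJK hx)
  refine Module.length_eq_add_of_exact f g ?_ ?_ ?_
  · rw [← LinearMap.ker_eq_bot, Submodule.ker_mapQ, hi, Submodule.mkQ_map_self]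
  · exact Submodule.factor_surjective _
  · intro x
    obtain ⟨x, rfl⟩ := Submodule.Quotient.mk_surjective _ x
    constructor
    · intro h
      have h : (x : R) ∈ K := (Submodule.Quotient.mk_eq_zero (K.submoduleOf I)).mp h
      exact ⟨Submodule.Quotient.mk ⟨x, h⟩, rfl⟩
    · rintro ⟨y, hy⟩
      obtain ⟨y, rfl⟩ := Submodule.Quotient.mk_surjective _ y
      rw [← hy]
      exact (Submodule.Quotient.mk_eq_zero (K.submoduleOf I)).mpr y.2

lemma eLength_mono {J K I : Ideal R} (hJK : J ≤ K) (hKI : K ≤ I) : eLength J K ≤ eLength J I :=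
  eLength_add hJK hKI ▸ le_self_add

lemma eLength_sup (J K : Ideal R) : eLength K (J ⊔ K) = eLength (J ⊓ K) J := by
  have h : (J ⊓ K).submoduleOf J = K.submoduleOf J := by
    ext x; simp [Submodule.submoduleOf]
  have h' : Submodule.comap J.subtype J ⊓ Submodule.comap J.subtype K = K.submoduleOf J := by
    ext x; simp [Submodule.submoduleOf]
  rw [eLength, eLength, h]
  exact ((LinearMap.quotientInfEquivSupQuotient J K).symm.trans
    (Submodule.quotEquivOfEq _ _ h')).length_eq

/-- Lengths of ideals above a given one are modular. -/
lemma eLength_sup_add_inf {A J K : Ideal R} (hJ : A ≤ J) (hK : A ≤ K) :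
    eLength A (J ⊔ K) + eLength A (J ⊓ K) = eLength A J + eLength A K := by
  rw [eLength_add hK le_sup_right, eLength_sup, eLength_add (le_inf hJ hK) inf_le_left]
  ac_rfl

lemma eLength_pos {J I : Ideal R} (h : J < I) : 0 < eLength J I := by
  rw [eLength, Module.length_pos_iff, Submodule.Quotient.nontrivial_iff]
  intro h'
  exact h.not_ge (Submodule.submoduleOf_eq_top.mp h')

variable [IsLocalRing R]

lemma eLength_sup_span_singleton {J : Ideal R} {x : R} (hx : x ∉ J)
    (hm : ∀ r ∈ maximalIdeal R, r * x ∈ J) : eLength J (J ⊔ Ideal.span {x}) = 1 := by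
  have hle : J ≤ J ⊔ Ideal.span {x} := le_sup_left
  have hxs : x ∈ J ⊔ Ideal.span {x} :=
    Ideal.mem_sup_right (Ideal.mem_span_singleton_self x)
  rw [eLength, Module.length_eq_one_iff, Submodule.submoduleOf,
    ← covBy_iff_quot_is_simple hle]
  refine ⟨lt_of_le_of_ne hle fun h => hx (h ▸ hxs), fun L hJL hL => ?_⟩
  obtain ⟨y, hyL, hyJ⟩ := SetLike.exists_of_lt hJL
  obtain ⟨j, hj, z, hz, rfl⟩ := Submodule.mem_sup.mp (hL.le hyL)
  obtain ⟨r, rfl⟩ := Ideal.mem_span_singleton'.mp hz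
  have hr : IsUnit r := by
    by_contra hr
    exact hyJ (J.add_mem hj (hm r hr))
  have hrx : r * x ∈ L := by simpa using L.sub_mem hyL (hJL.le hj)
  have hxL : x ∈ L := (Ideal.unit_mul_mem_iff_mem L hr).mp hrx
  exact hL.not_ge (sup_le hJL.le ((Ideal.span_singleton_le_iff_mem _).mpr hxL))

/-- `I / J` has a nonzero socle element when a power of the maximal ideal lies in `J`. -/
lemma exists_socle_element {J I : Ideal R} {N : ℕ} (hN : maximalIdeal R ^ N ≤ J) (hJI : J < I) :
    ∃ x ∈ I, x ∉ J ∧ ∀ r ∈ maximalIdeal R, r * x ∈ J := by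
  classical
  have hex : ∃ n, maximalIdeal R ^ n * I ≤ J := ⟨N, Ideal.mul_le_left.trans hN⟩
  have hspec := Nat.find_spec hex
  have h0 : Nat.find hex ≠ 0 := by
    intro h
    rw [h, pow_zero, one_mul] at hspec
    exact hJI.not_ge hspec
  obtain ⟨n, hn⟩ := Nat.exists_eq_succ_of_ne_zero h0
  have hmin : ¬ maximalIdeal R ^ n * I ≤ J := Nat.find_min hex (by omega)
  obtain ⟨x, hx, hxJ⟩ := SetLike.not_le_iff_exists.mp hmin
  refine ⟨x, Ideal.mul_le_right hx, hxJ, fun r hr => hspec ?_⟩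
  rw [hn, pow_succ', mul_assoc]
  exact Ideal.mul_mem_mul hr hx

variable [IsNoetherianRing R]

lemma eLength_ne_top {J : Ideal R} {N : ℕ} (hN : maximalIdeal R ^ N ≤ J)
    {I : Ideal R} (hJI : J ≤ I) : eLength J I ≠ ⊤ := by
  induction J using WellFoundedGT.induction with
  | ind J ih =>
    rcases hJI.eq_or_lt with rfl | hlt
    · simp [eLength_self]
    obtain ⟨x, hxI, hxJ, hm⟩ := exists_socle_element hN hlt
    have hJK : J < J ⊔ Ideal.span {x} := by simpa using hxJ
    have hKI : J ⊔ Ideal.span {x} ≤ I := sup_le hJI ((Ideal.span_singleton_le_iff_mem _).mpr hxI)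
    rw [eLength_add hJK.le hKI, eLength_sup_span_singleton hxJ hm]
    exact WithTop.add_ne_top.mpr ⟨ENat.one_ne_top, ih _ hJK (hN.trans hJK.le) hKI⟩

/-- A local homomorphism that extends the maximal ideal to the maximal ideal, and along which
the ideals above `A` are contracted from their extensions, preserves the lengths between ideals
above `A`: each step of a composition series stays simple. -/
lemma eLength_map {C : Type v} [CommRing C] [IsLocalRing C] (f : R →+* C)
    (hf : (maximalIdeal R).map f = maximalIdeal C) {A : Ideal R}
    (hA : ∀ J, A ≤ J → (J.map f).comap f = J) {N : ℕ} (hN : maximalIdeal R ^ N ≤ A)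
    {J I : Ideal R} (hAJ : A ≤ J) (hJI : J ≤ I) :
    eLength (J.map f) (I.map f) = eLength J I := by
  induction J using WellFoundedGT.induction with
  | ind J ih =>
    rcases hJI.eq_or_lt with rfl | hlt
    · simp [eLength_self]
    obtain ⟨x, hxI, hxJ, hm⟩ := exists_socle_element (hN.trans hAJ) hlt
    have hJK : J < J ⊔ Ideal.span {x} := by simpa using hxJ
    have hKI : J ⊔ Ideal.span {x} ≤ I := sup_le hJI ((Ideal.span_singleton_le_iff_mem _).mpr hxI)
    have hfx : f x ∉ J.map f := by
      rwa [← Ideal.mem_comap, hA J hAJ]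
    have hfm : ∀ r ∈ maximalIdeal C, r * f x ∈ J.map f := by
      intro r hr
      have hle : maximalIdeal R * Ideal.span {x} ≤ J := by
        rw [mul_comm, Ideal.span_singleton_mul_le_iff]
        intro z hz
        rw [mul_comm]
        exact hm z hz
      have := Ideal.map_mono (f := f) hle
      rw [Ideal.map_mul, hf, Ideal.map_span, Set.image_singleton] at this
      exact this (Ideal.mul_mem_mul hr (Ideal.mem_span_singleton_self _))
    rw [eLength_add hJK.le hKI, eLength_add (Ideal.map_mono hJK.le) (Ideal.map_mono hKI),
      ih _ hJK (hAJ.trans hJK.le) hKI, eLength_sup_span_singleton hxJ hm, Ideal.map_sup,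
      Ideal.map_span, Set.image_singleton, eLength_sup_span_singleton hfx hfm]

end Length

/-! ### Minimal slopes of submodular functions -/

/-- Let `f` be submodular and `d` modular and strictly increasing on a sublattice `s` with least
element `o`, with `f o = d o = 0`. Among the elements of minimal slope `f / d` in `s \ {o}`, the one
with the largest `d` contains every element with the same `f` and `d`. -/
lemma exists_greatest_of_minimal_slope {α : Type*} [Lattice α] {s : Set α} {o : α} {f d : α → ℕ}
    (hsup : ∀ x ∈ s, ∀ y ∈ s, x ⊔ y ∈ s) (hinf : ∀ x ∈ s, ∀ y ∈ s, x ⊓ y ∈ s)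
    (hos : o ∈ s) (ho : ∀ x ∈ s, o ≤ x) (hne : ∃ x ∈ s, o < x)
    (hf : ∀ x ∈ s, ∀ y ∈ s, f (x ⊔ y) + f (x ⊓ y) ≤ f x + f y)
    (hd : ∀ x ∈ s, ∀ y ∈ s, d (x ⊔ y) + d (x ⊓ y) = d x + d y)
    (hd0 : d o = 0) (hmono : ∀ x ∈ s, ∀ y ∈ s, x < y → d x < d y)
    {N : ℕ} (hfN : ∀ x ∈ s, f x ≤ N) (hdN : ∀ x ∈ s, d x ≤ N) :
    ∃ x ∈ s, o < x ∧ (∀ y ∈ s, o < y → (f x : ℝ) / d x ≤ f y / d y) ∧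
      ∀ y ∈ s, f y = f x → d y = d x → y ≤ x := by
  have hpos : ∀ x ∈ s, o < x → 0 < d x := fun x hx h => hd0 ▸ hmono o hos x hx h
  let t : Set α := {x | x ∈ s ∧ o < x}
  have hfin : ((fun x => (f x : ℝ) / d x) '' t).Finite := by
    refine ((Finset.range (N + 1) ×ˢ Finset.range (N + 1)).image
      fun a : ℕ × ℕ => (a.1 : ℝ) / a.2).finite_toSet.subset ?_
    rintro _ ⟨x, hx, rfl⟩
    have h1 := hfN x hx.1
    have h2 := hdN x hx.1
    simp only [Finset.coe_image, Set.mem_image, Finset.mem_coe, Finset.mem_product,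
      Finset.mem_range]
    exact ⟨(f x, d x), ⟨by simp only; omega, by simp only; omega⟩, rfl⟩
  obtain ⟨x₀, hx₀⟩ : t.Nonempty := hne
  obtain ⟨_, ⟨x₁, hx₁, rfl⟩, hmin⟩ := Set.exists_min_image _ id hfin ⟨_, x₀, hx₀, rfl⟩
  simp only [id, Set.forall_mem_image] at hmin
  set μ : ℝ := f x₁ / d x₁
  have hle : ∀ y ∈ s, μ * d y ≤ f y := by
    intro y hy
    rcases (ho y hy).eq_or_lt with rfl | hlt
    · simp [hd0]
    · exact (le_div_iff₀ (by exact_mod_cast hpos y hy hlt)).mp (hmin ⟨hy, hlt⟩)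
  let T : Set α := {x | x ∈ t ∧ (f x : ℝ) = μ * d x}
  have hT₁ : x₁ ∈ T :=
    ⟨hx₁, (div_mul_cancel₀ _ (by exact_mod_cast (hpos x₁ hx₁.1 hx₁.2).ne')).symm⟩
  obtain ⟨_, ⟨x, hxT, rfl⟩, hmax⟩ := Set.exists_max_image (d '' T) id
    ((Set.finite_Iic N).subset (by rintro _ ⟨x, hx, rfl⟩; exact hdN x hx.1.1)) ⟨_, x₁, hT₁, rfl⟩
  simp only [id, Set.forall_mem_image] at hmax
  obtain ⟨⟨hxs, hox⟩, hfx⟩ := hxT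
  refine ⟨x, hxs, hox, fun y hy hoy => ?_, fun y hy hfy hdy => ?_⟩
  · rw [hfx, mul_div_cancel_right₀ _ (by exact_mod_cast (hpos x hxs hox).ne')]
    exact hmin ⟨hy, hoy⟩
  · have hs := hsup x hxs y hy
    have h1 := hle _ (hinf x hxs y hy)
    have h2 : (f (x ⊔ y) : ℝ) + f (x ⊓ y) ≤ f x + f y := by exact_mod_cast hf x hxs y hy
    have h3 : (d (x ⊔ y) : ℝ) + d (x ⊓ y) = d x + d y := by exact_mod_cast hd x hxs y hy
    rw [hfy, hdy] at *
    -- The slope of `x ⊔ y` is minimal as well, so `d (x ⊔ y) ≤ d x`.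
    have hmem : x ⊔ y ∈ T := by
      refine ⟨⟨hs, hox.trans_le le_sup_left⟩, le_antisymm ?_ (hle _ hs)⟩
      have := congrArg (μ * ·) h3
      simp only [mul_add] at this
      linarith
    by_contra hyx
    exact (hmono x hxs _ hs (left_lt_sup.mpr hyx)).not_ge (hmax hmem)

/-! ### Galois descent of ideals -/

section Descent

open TensorProduct

variable {R : Type u} {C : Type v} [CommRing R] [CommRing C] [Algebra R C]
  {G : Type*} [Group G] [Fintype G] (L : G →* (C ≃ₐ[R] C))

/-- The sum of the conjugates of an element under a group acting by automorphisms. -/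
def orbitSum (x : C) : C := ∑ σ, L σ x

lemma apply_orbitSum (τ : G) (x : C) : L τ (orbitSum L x) = orbitSum L x := by
  simp only [orbitSum, map_sum, ← AlgEquiv.mul_apply, ← map_mul]
  exact Fintype.sum_equiv (Equiv.mulLeft τ) _ _ fun σ => rfl

lemma orbitSum_mul_of_fixed {z : C} (hz : ∀ σ, L σ z = z) (x : C) :
    orbitSum L (z * x) = z * orbitSum L x := by
  simp [orbitSum, hz, Finset.mul_sum]

/-- If for each `σ ≠ 1` some difference `y - σ y` is a unit, then there is a tensor `t` that
`a ⊗ b ↦ a * σ b` sends to `1` for `σ = 1` and to `0` otherwise: multiply, over all `σ ≠ 1`, tensors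
that are sent to `1` for the identity and to `0` for the given `σ`. -/
lemma exists_galois_tensor (hL : ∀ σ : G, σ ≠ 1 → ∃ y : C, IsUnit (y - L σ y)) :
    ∃ t : C ⊗[R] C, Algebra.TensorProduct.lift (AlgHom.id R C) (L 1 : C →ₐ[R] C)
        (fun _ _ => Commute.all _ _) t = 1 ∧
      ∀ σ : G, σ ≠ 1 → Algebra.TensorProduct.lift (AlgHom.id R C) (L σ : C →ₐ[R] C)
        (fun _ _ => Commute.all _ _) t = 0 := by
  classical
  choose! y hy using hL
  choose! u hu using fun σ h => (hy σ h).exists_left_inv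
  refine ⟨∏ σ ∈ Finset.univ.erase (1 : G),
    (u σ ⊗ₜ[R] y σ - (u σ * L σ (y σ)) ⊗ₜ[R] 1), ?_, fun σ hσ => ?_⟩
  · rw [map_prod]
    refine Finset.prod_eq_one fun σ hσ => ?_
    have := hu σ (Finset.ne_of_mem_erase hσ)
    simp only [map_sub, Algebra.TensorProduct.lift_tmul, map_one]
    simpa [mul_sub] using this
  · rw [map_prod]
    refine Finset.prod_eq_zero (Finset.mem_erase.mpr ⟨hσ, Finset.mem_univ _⟩) ?_
    simp

/-- Every element `x` of an ideal `J` is a combination of orbit sums of elements of `J`: if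
`t = ∑ aᵢ ⊗ bᵢ` is the tensor of `exists_galois_tensor`, then `x = ∑ aᵢ * orbitSum (bᵢ * x)`. -/
lemma mem_span_orbitSum (hL : ∀ σ : G, σ ≠ 1 → ∃ y : C, IsUnit (y - L σ y))
    {J : Ideal C} {x : C} (hx : x ∈ J) :
    x ∈ Ideal.span ((orbitSum L) '' (J : Set C)) := by
  classical
  obtain ⟨t, h1, ht⟩ := exists_galois_tensor L hL
  have key : ∀ t : C ⊗[R] C, ∑ σ, Algebra.TensorProduct.lift (AlgHom.id R C) (L σ : C →ₐ[R] C)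
      (fun _ _ => Commute.all _ _) t * L σ x ∈ Ideal.span ((orbitSum L) '' (J : Set C)) := by
    intro t
    induction t using TensorProduct.induction_on with
    | zero => simp
    | add a b ha hb =>
      simp only [map_add, add_mul, Finset.sum_add_distrib]
      exact Ideal.add_mem _ ha hb
    | tmul a b =>
      have : ∑ σ, Algebra.TensorProduct.lift (AlgHom.id R C) (L σ : C →ₐ[R] C)
          (fun _ _ => Commute.all _ _) (a ⊗ₜ[R] b) * L σ x = a * orbitSum L (b * x) := by
        simp [orbitSum, Finset.mul_sum, mul_assoc]
      rw [this]
      exact Ideal.mul_mem_left _ _ (Ideal.subset_span ⟨b * x, J.mul_mem_left b hx, rfl⟩)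
  have := key t
  rw [Finset.sum_eq_single 1 (fun σ _ hσ => by rw [ht σ hσ, zero_mul]) (by simp), h1] at this
  simpa using this

variable {k K : Type*} [Field k] [Field K] [Algebra R k] [Algebra R K] [Algebra k K]
  [IsScalarTower R k K] (φ : C →ₐ[R] K)

/-- Invariants of a lift of a Galois extension `K / k` along a nilpotent ideal come from the
base ring. An invariant is approximated by elements of `R` modulo increasing powers of the ideal;
an element of orbit sum `1` writes an invariant error term as an orbit sum, whose coefficients
are invariants and can be approximated in turn. -/
lemma mem_range_of_fixed [IsLocalRing R] [FiniteDimensional k K] [IsGalois k K]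
    (hk : Function.Surjective (algebraMap R k)) (L : Gal(K/k) →* (C ≃ₐ[R] C))
    (hφ : ∀ σ x, φ (L σ x) = σ (φ x))
    (hker : RingHom.ker φ = (maximalIdeal R).map (algebraMap R C))
    (hnil : IsNilpotent (RingHom.ker φ)) (hloc : ∀ z : C, φ z ≠ 0 → IsUnit z)
    (hL : ∀ σ : Gal(K/k), σ ≠ 1 → ∃ y : C, IsUnit (y - L σ y))
    {x : C} (hx : ∀ σ, L σ x = x) : x ∈ (algebraMap R C).range := by
  classical
  -- An element of orbit sum `1`.
  obtain ⟨c, hc⟩ : ∃ c : C, orbitSum L c = 1 := by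
    obtain ⟨y, hy⟩ : ∃ y : C, φ (orbitSum L y) ≠ 0 := by
      by_contra! h
      have h1 := mem_span_orbitSum L hL (J := ⊤) (x := 1) trivial
      have hle : Ideal.span ((orbitSum L) '' ((⊤ : Ideal C) : Set C)) ≤ RingHom.ker φ := by
        rw [Ideal.span_le]
        rintro _ ⟨y, -, rfl⟩
        exact h y
      have := hle h1
      simp [RingHom.mem_ker] at this
    obtain ⟨u, hu⟩ := (hloc _ hy).exists_left_inv
    have hfix : ∀ σ, L σ u = u := by
      intro σ
      have h2 : L σ u * orbitSum L y = 1 := by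
        rw [← apply_orbitSum L σ y, ← map_mul, hu, map_one]
      exact (hloc _ hy).mul_right_cancel (h2.trans hu.symm)
    exact ⟨u * y, by rw [orbitSum_mul_of_fixed L hfix, hu]⟩
  have hfixed : ∀ z, ∀ σ, L σ (orbitSum L z) = orbitSum L z := fun z σ => apply_orbitSum L σ z
  have hbase : ∀ z : C, (∀ σ, L σ z = z) → ∃ r : R, z - algebraMap R C r ∈ RingHom.ker φ := by
    intro z hz
    obtain ⟨a, ha⟩ : φ z ∈ (⊥ : IntermediateField k K) := by
      rw [IsGalois.mem_bot_iff_fixed]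
      intro σ
      rw [← hφ, hz]
    obtain ⟨r, rfl⟩ := hk a
    refine ⟨r, ?_⟩
    rw [RingHom.mem_ker, map_sub, ← ha]
    simp [← IsScalarTower.algebraMap_apply]
  have hsum : ∀ n : ℕ, ∀ z ∈ (RingHom.ker φ) ^ n, ∀ a : C,
      ∃ r : R, orbitSum L (a * z) - algebraMap R C r ∈ (RingHom.ker φ) ^ (n + 1) := by
    intro n z hz
    have hz' : z ∈ Ideal.span (algebraMap R C '' (maximalIdeal R ^ n : Ideal R)) := by
      rwa [hker, ← Ideal.map_pow] at hz
    clear hz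
    induction hz' using Submodule.span_induction with
    | zero => exact fun a => ⟨0, by simp [orbitSum]⟩
    | add z w _ _ hz hw =>
      intro a
      obtain ⟨r, hr⟩ := hz a
      obtain ⟨s, hs⟩ := hw a
      refine ⟨r + s, ?_⟩
      convert Ideal.add_mem _ hr hs using 1
      simp only [orbitSum, mul_add, map_add, Finset.sum_add_distrib]
      ring
    | smul b z _ hz => exact fun a => by simpa [mul_assoc] using hz (a * b)
    | mem z hz =>
      obtain ⟨m, hm, rfl⟩ := hz
      intro a
      obtain ⟨r, hr⟩ := hbase (orbitSum L a) (hfixed a)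
      refine ⟨m * r, ?_⟩
      rw [mul_comm a, orbitSum_mul_of_fixed L (by simp), map_mul, ← mul_sub, pow_succ]
      refine Ideal.mul_mem_mul ?_ hr
      rw [hker, ← Ideal.map_pow]
      exact Ideal.mem_map_of_mem _ hm
  have step : ∀ n : ℕ, ∃ r : R, x - algebraMap R C r ∈ (RingHom.ker φ) ^ n := by
    intro n
    induction n with
    | zero => exact ⟨0, by simp⟩
    | succ n ih =>
      obtain ⟨r, hr⟩ := ih
      obtain ⟨s, hs⟩ := hsum n _ hr c
      refine ⟨r + s, ?_⟩
      rw [mul_comm, orbitSum_mul_of_fixed L (by simp [hx]), hc, mul_one] at hs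
      simpa [sub_sub] using hs
  obtain ⟨n, hn⟩ := hnil
  obtain ⟨r, hr⟩ := step n
  rw [hn] at hr
  exact ⟨r, (sub_eq_zero.mp hr).symm⟩

/-- Galois descent of ideals: if the automorphisms of a Galois extension `K / k` lift to `C`, every
stable ideal of `C` is extended from the base ring. -/
lemma map_comap_eq_of_stable [IsLocalRing R] [FiniteDimensional k K] [IsGalois k K]
    (hk : Function.Surjective (algebraMap R k)) (L : Gal(K/k) →* (C ≃ₐ[R] C))
    (hsurj : Function.Surjective φ) (hφ : ∀ σ x, φ (L σ x) = σ (φ x))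
    (hker : RingHom.ker φ = (maximalIdeal R).map (algebraMap R C))
    (hnil : IsNilpotent (RingHom.ker φ))
    {J : Ideal C} (hJ : ∀ σ, ∀ x ∈ J, L σ x ∈ J) :
    (J.comap (algebraMap R C)).map (algebraMap R C) = J := by
  have hloc : ∀ z : C, φ z ≠ 0 → IsUnit z := by
    intro z hz
    obtain ⟨w, hw⟩ := hsurj (φ z)⁻¹
    obtain ⟨n, hn⟩ := hnil
    have h : 1 - z * w ∈ RingHom.ker φ := by simp [RingHom.mem_ker, hw, hz]
    have hnilp : IsNilpotent (1 - z * w) := by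
      refine ⟨n, ?_⟩
      have := Ideal.pow_mem_pow h n
      rwa [hn] at this
    have := hnilp.isUnit_one_sub
    rw [sub_sub_cancel] at this
    exact isUnit_of_mul_isUnit_left this
  have hL : ∀ σ : Gal(K/k), σ ≠ 1 → ∃ y : C, IsUnit (y - L σ y) := by
    intro σ hσ
    obtain ⟨a, ha⟩ : ∃ a, σ a ≠ a := by
      by_contra! h
      exact hσ (AlgEquiv.ext h)
    obtain ⟨y, rfl⟩ := hsurj a
    refine ⟨y, hloc _ ?_⟩
    rw [map_sub, hφ, sub_ne_zero]
    exact ha.symm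
  refine le_antisymm Ideal.map_comap_le fun x hx => ?_
  refine Ideal.span_mono ?_ (mem_span_orbitSum L hL hx)
  rintro _ ⟨y, hy, rfl⟩
  obtain ⟨r, hr⟩ := mem_range_of_fixed φ hk L hφ hker hnil hloc hL
    (fun σ => apply_orbitSum L σ y)
  refine ⟨r, ?_, hr⟩
  change algebraMap R C r ∈ J
  rw [show algebraMap R C r = orbitSum L y from hr]
  exact J.sum_mem fun σ _ => hJ σ y hy

end Descent

/-! ### Lifting residue field extensions and their automorphisms -/

section Lift

variable {R : Type u} {T : Type v} [CommRing R] [CommRing T] [Algebra R T]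
  [Algebra.FormallyEtale R T]
  {k K : Type*} [Field k] [Field K] [Algebra R k] [Algebra R K] [Algebra k K]
  [IsScalarTower R k K]

/-- Automorphisms of a residue field of a quotient `T / 𝔞T` of a formally étale `R`-algebra `T`
lift to the quotient, uniquely and hence multiplicatively. -/
lemma exists_lift_galois (𝔞 : Ideal R)
    (φ : (T ⧸ 𝔞.map (algebraMap R T)) →ₐ[R] K) (hφ : Function.Surjective φ)
    (hnil : IsNilpotent (RingHom.ker φ)) :
    ∃ L : Gal(K/k) →* ((T ⧸ 𝔞.map (algebraMap R T)) ≃ₐ[R] (T ⧸ 𝔞.map (algebraMap R T))),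
      ∀ σ x, φ (L σ x) = σ (φ x) := by
  set C := T ⧸ 𝔞.map (algebraMap R T)
  have hC : Algebra.FormallyUnramified R C :=
    have : Algebra.FormallyUnramified T C := .quotient _
    .comp R T C
  have huniq : ∀ τ₁ τ₂ : C →ₐ[R] C, (∀ x, φ (τ₁ x) = φ (τ₂ x)) → τ₁ = τ₂ := fun τ₁ τ₂ h =>
    Algebra.FormallyUnramified.ext' (φ : C →+* K) hnil τ₁ τ₂ h
  have hex : ∀ σ : Gal(K/k), ∃ τ : C →ₐ[R] C, ∀ x, φ (τ x) = σ (φ x) := by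
    intro σ
    -- Lift `T → C → K` followed by `σ` to `C`; being `R`-linear, the lift kills `𝔞T`.
    let g : T →ₐ[R] K :=
      ((σ : K →ₐ[k] K).restrictScalars R).comp (φ.comp (Ideal.Quotient.mkₐ R _))
    let τ₀ := Algebra.FormallySmooth.liftOfSurjective g φ hφ hnil
    have hτ₀ : ∀ x, φ (τ₀ x) = g x :=
      Algebra.FormallySmooth.liftOfSurjective_apply g φ hφ hnil
    have hker : ∀ a ∈ 𝔞.map (algebraMap R T), τ₀ a = 0 := by
      have : 𝔞.map (algebraMap R T) ≤ RingHom.ker τ₀ := by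
        rw [Ideal.map_le_iff_le_comap]
        intro a ha
        rw [Ideal.mem_comap, RingHom.mem_ker, AlgHom.commutes]
        exact Ideal.Quotient.eq_zero_iff_mem.mpr (Ideal.mem_map_of_mem _ ha)
      exact this
    refine ⟨Ideal.Quotient.liftₐ _ τ₀ hker, fun x => ?_⟩
    obtain ⟨x, rfl⟩ := Ideal.Quotient.mk_surjective x
    exact hτ₀ x
  choose τ hτ using hex
  let L₀ : Gal(K/k) →* (C →ₐ[R] C) :=
    { toFun := τ
      map_one' := huniq _ _ fun x => by simp [hτ]
      map_mul' := fun σ σ' => huniq _ _ fun x => by simp [hτ] }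
  exact ⟨(AlgEquiv.algHomUnitsEquiv R C).toMonoidHom.comp L₀.toHomUnits, fun σ x => hτ σ x⟩

end Lift

section Cover

open Polynomial

variable (S : Type v) [CommRing S] [IsLocalRing S]

/-- `S[X] / (g)` is the standard étale algebra of the pair `(g, 1)`. -/
lemma formallyEtale_adjoinRoot {S : Type v} [CommRing S] {g : S[X]} (hg : g.Monic)
    (hd : IsUnit (AdjoinRoot.mk g (derivative g))) : Algebra.FormallyEtale S (AdjoinRoot g) := by
  obtain ⟨b, hb⟩ := hd.exists_right_inv
  obtain ⟨b, rfl⟩ := AdjoinRoot.mk_surjective b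
  obtain ⟨c, hc⟩ : g ∣ derivative g * b - 1 := by
    rw [← AdjoinRoot.mk_eq_zero, map_sub, map_mul, hb, map_one, sub_self]
  let P : StandardEtalePair S :=
    { f := g
      monic_f := hg
      g := 1
      cond := ⟨b, -c, 1, by linear_combination hc⟩ }
  have hP : IsUnit (AdjoinRoot.mk P.f P.g) := by simp [P]
  have hloc : Submonoid.powers (AdjoinRoot.mk P.f P.g) ≤ IsUnit.submonoid (AdjoinRoot P.f) := by
    rw [Submonoid.powers_le]
    exact hP
  let e : AdjoinRoot P.f ≃ₐ[S] Localization.Away (AdjoinRoot.mk P.f P.g) :=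
    (IsLocalization.atUnits (AdjoinRoot P.f) _ hloc).restrictScalars S
  exact .of_equiv (P.equivAwayAdjoinRoot.trans e.symm)

/-- Every finite separable extension of the residue field of a local ring is the residue field of a
finite free local algebra that is formally étale and extends the maximal ideal to the maximal
ideal: adjoin a root of a lift of the minimal polynomial of a primitive element. -/
lemma exists_etale_cover_of_residueField (K : Type*) [Field K] [Algebra (ResidueField S) K]
    [FiniteDimensional (ResidueField S) K] [Algebra.IsSeparable (ResidueField S) K] :
    ∃ (T : Type v) (_ : CommRing T) (_ : IsLocalRing T) (_ : Algebra S T) (φ : T →+* K),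
      Module.Finite S T ∧ Module.Free S T ∧ Algebra.FormallyEtale S T ∧
      Function.Surjective φ ∧ (maximalIdeal S).map (algebraMap S T) = maximalIdeal T ∧
      φ.comp (algebraMap S T) = (algebraMap (ResidueField S) K).comp (residue S) := by
  obtain ⟨α, hα⟩ := Field.exists_primitive_element (ResidueField S) K
  have hint : IsIntegral (ResidueField S) α := .of_finite _ _
  set h := minpoly (ResidueField S) α
  obtain ⟨g, hgmap, hgdeg, hg⟩ := Polynomial.lifts_and_degree_eq_and_monic
    ((Polynomial.mem_lifts h).mpr (Polynomial.map_surjective _ residue_surjective h))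
    (minpoly.monic hint)
  let T := AdjoinRoot g
  let ι : S →+* K := (algebraMap (ResidueField S) K).comp (residue S)
  have hι : g.eval₂ ι α = 0 := by
    rw [← Polynomial.eval₂_map, hgmap]
    exact minpoly.aeval _ _
  let φ : T →+* K := AdjoinRoot.lift ι α hι
  have hφmk : ∀ q : S[X], φ (AdjoinRoot.mk g q) = aeval α (q.map (residue S)) := by
    intro q
    rw [AdjoinRoot.lift_mk, aeval_def, Polynomial.eval₂_map]
  have hφ : Function.Surjective φ := by
    intro x
    have hx : x ∈ Algebra.adjoin (ResidueField S) {α} := by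
      rw [← IntermediateField.adjoin_simple_toSubalgebra_of_isAlgebraic hint.isAlgebraic, hα]
      trivial
    rw [Algebra.adjoin_singleton_eq_range_aeval] at hx
    obtain ⟨q, rfl⟩ := hx
    obtain ⟨q, rfl⟩ := Polynomial.map_surjective _ residue_surjective q
    exact ⟨AdjoinRoot.mk g q, hφmk q⟩
  have hker : RingHom.ker φ = (maximalIdeal S).map (algebraMap S T) := by
    refine le_antisymm (fun x hx => ?_) ?_
    · obtain ⟨q, rfl⟩ := AdjoinRoot.mk_surjective x
      rw [RingHom.mem_ker, hφmk] at hx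
      obtain ⟨r, hr⟩ := minpoly.dvd _ _ hx
      obtain ⟨r, rfl⟩ := Polynomial.map_surjective _ residue_surjective r
      have hq : q - g * r ∈ (maximalIdeal S).map (C : S →+* S[X]) := by
        rw [← ker_residue, ← Polynomial.ker_mapRingHom, RingHom.mem_ker]
        simp [hr, hgmap, h]
      have := Ideal.mem_map_of_mem (AdjoinRoot.mk g) hq
      rw [Ideal.map_map, map_sub, map_mul, AdjoinRoot.mk_self, zero_mul, sub_zero] at this
      exact this
    · rw [Ideal.map_le_iff_le_comap]
      intro a ha
      have : φ (algebraMap S T a) = ι a := AdjoinRoot.lift_of hι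
      rw [Ideal.mem_comap, RingHom.mem_ker, this]
      simp [ι, (residue_eq_zero_iff a).mpr ha]
  have hfin : Module.Finite S T := hg.finite_adjoinRoot
  have hmax : (RingHom.ker φ).IsMaximal := RingHom.ker_isMaximal_of_surjective φ hφ
  have hloc : IsLocalRing T := by
    -- By integrality every maximal ideal of `T` lies over that of `S`, so it contains `ker φ`.
    refine .of_unique_max_ideal ⟨RingHom.ker φ, hmax, fun M hM => ?_⟩
    have hMS : (M.comap (algebraMap S T)).IsMaximal := Ideal.isMaximal_comap_of_isIntegral_of_isMaximal M
    refine (hmax.eq_of_le hM.ne_top ?_).symm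
    rw [hker, Ideal.map_le_iff_le_comap, eq_maximalIdeal hMS]
  have hkerT : RingHom.ker φ = maximalIdeal T := eq_maximalIdeal hmax
  refine ⟨T, inferInstance, hloc, inferInstance, φ, hfin, hg.free_adjoinRoot, ?_, hφ,
    hker.symm.trans hkerT, ?_⟩
  · refine formallyEtale_adjoinRoot hg ?_
    have : AdjoinRoot.mk g (derivative g) ∉ maximalIdeal T := by
      rw [← hkerT, RingHom.mem_ker, hφmk, ← derivative_map, hgmap]
      exact (Algebra.IsSeparable.isSeparable (ResidueField S) α).aeval_derivative_ne_zero
        (minpoly.aeval _ _)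
    exact not_not.mp fun hu => this ((mem_maximalIdeal _).mpr hu)
  · ext a
    exact AdjoinRoot.lift_of hι

end Cover

/-! ### The Galois cover of an étale-local map -/

section EtaleLocal

variable {R : Type u} {S : Type v} [CommRing R] [IsLocalRing R] [CommRing S] [IsLocalRing S]
  [Algebra R S]

lemma IsEtaleLocal.formallyEtale_flat_essFiniteType (h : IsEtaleLocal R S) :
    Algebra.FormallyEtale R S ∧ Module.Flat R S ∧ Algebra.EssFiniteType R S := by
  obtain ⟨-, B, _, _, _, _, M, _, _⟩ := h
  have : Algebra.FormallyEtale B S := .of_isLocalization M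
  have : Module.Flat B S := IsLocalization.flat S M
  have : Algebra.EssFiniteType B S := .of_isLocalization S M
  exact ⟨.comp R B S, .trans R B S, .comp R B S⟩

/-- By going down, the dimensions differ by that of the closed fibre, which is a field. -/
lemma dimNat_eq_of_flat [IsNoetherianRing R] [IsNoetherianRing S] [IsLocalHom (algebraMap R S)]
    [Module.Flat R S] (h : (maximalIdeal R).map (algebraMap R S) = maximalIdeal S) :
    dimNat R = dimNat S := by
  have hlies : (maximalIdeal S).LiesOver (maximalIdeal R) :=
    ⟨((local_hom_TFAE (algebraMap R S)).out 0 4 rfl rfl |>.mp ‹_›).symm⟩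
  have := Ideal.height_eq_height_add_of_liesOver_of_hasGoingDown (maximalIdeal R) (maximalIdeal S)
  have hnt : Nontrivial (S ⧸ (maximalIdeal R).map (algebraMap R S)) := by
    rw [h]; infer_instance
  rw [show (maximalIdeal S).map (Ideal.Quotient.mk ((maximalIdeal R).map (algebraMap R S))) = ⊥ by
    rw [Ideal.map_eq_bot_iff_le_ker, Ideal.mk_ker, h], Ideal.height_bot, add_zero] at this
  rw [dimNat, dimNat, ← maximalIdeal_height_eq_ringKrullDim,
    ← maximalIdeal_height_eq_ringKrullDim, this]

end EtaleLocal

/-- A finite separable extension `L / k` embeds in a finite Galois extension of `k`. -/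
lemma exists_galois_extension (k : Type u) (L : Type v) [Field k] [Field L] [Algebra k L]
    [FiniteDimensional k L] [Algebra.IsSeparable k L] :
    ∃ (K : Type v) (_ : Field K) (_ : Algebra k K) (_ : Algebra L K),
      IsScalarTower k L K ∧ FiniteDimensional k K ∧ IsGalois k K := by
  let K := IntermediateField.normalClosure k L (AlgebraicClosure L)
  refine ⟨K, inferInstance, inferInstance, inferInstance, inferInstance, inferInstance, ?_⟩
  have hsep : Algebra.IsSeparable k K := by
    have : ∀ f : L →ₐ[k] AlgebraicClosure L, Algebra.IsSeparable k f.fieldRange := fun f =>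
      .of_algHom k L (AlgEquiv.ofInjectiveField f).symm.toAlgHom
    exact IntermediateField.isSeparable_iSup (h := this)
  exact ⟨⟩

section GaloisCover

/-- Along a faithfully flat homomorphism followed by the quotient by the extension of `𝔞`, ideals
above `𝔞` are contracted from their extensions. -/
lemma comap_map_quotient {R : Type u} {T : Type v} [CommRing R] [CommRing T] [Algebra R T]
    [Module.FaithfullyFlat R T] {𝔞 J : Ideal R} {𝔟 : Ideal T}
    (h𝔟 : 𝔟 = 𝔞.map (algebraMap R T)) (hJ : 𝔞 ≤ J) :
    (J.map ((Ideal.Quotient.mk 𝔟).comp (algebraMap R T))).comap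
      ((Ideal.Quotient.mk 𝔟).comp (algebraMap R T)) = J := by
  have h : 𝔟 ≤ J.map (algebraMap R T) := h𝔟 ▸ Ideal.map_mono hJ
  rw [← Ideal.map_map, ← Ideal.comap_comap,
    Ideal.comap_map_of_surjective _ Ideal.Quotient.mk_surjective, ← RingHom.ker_eq_comap_bot,
    Ideal.mk_ker, sup_eq_left.mpr h, Ideal.comap_map_eq_self_of_faithfullyFlat]

/-- For an étale-local map `R → S` and an ideal `𝔞` of `R` that is primary to the maximal ideal,
there is a local ring `C` over `S`, the quotient by `𝔞` of a finite étale local `S`-algebra, such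
that every ideal of `C` stable under the `R`-automorphisms of `C` is extended from `R`. -/
lemma exists_galois_cover {R : Type u} {S : Type v} [CommRing R] [IsLocalRing R] [CommRing S]
    [IsLocalRing S] [Algebra R S] [IsNoetherianRing S] (hRS : IsEtaleLocal R S)
    {𝔞 : Ideal R} {N : ℕ} (hN : maximalIdeal R ^ N ≤ 𝔞) (h𝔞 : 𝔞 ≤ maximalIdeal R) :
    ∃ (C : Type v) (_ : CommRing C) (_ : IsLocalRing C) (_ : IsNoetherianRing C) (g : S →+* C),
      (maximalIdeal S).map g = maximalIdeal C ∧ maximalIdeal C ^ N = ⊥ ∧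
      (∀ J, 𝔞 ≤ J → (J.map (g.comp (algebraMap R S))).comap (g.comp (algebraMap R S)) = J) ∧
      (∀ J, 𝔞.map (algebraMap R S) ≤ J → (J.map g).comap g = J) ∧
      ∀ J : Ideal C, (∀ τ : C ≃+* C, (τ : C →+* C).comp (g.comp (algebraMap R S)) =
        g.comp (algebraMap R S) → ∀ x ∈ J, τ x ∈ J) →
        (J.comap (g.comp (algebraMap R S))).map (g.comp (algebraMap R S)) = J := by
  have := hRS.1
  obtain ⟨_, _, _⟩ := hRS.formallyEtale_flat_essFiniteType
  have hmS : (maximalIdeal R).map (algebraMap R S) = maximalIdeal S :=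
    Algebra.FormallyUnramified.map_maximalIdeal
  obtain ⟨K, _, _, _, _, _, _⟩ :=
    exists_galois_extension (ResidueField R) (ResidueField S)
  have : FiniteDimensional (ResidueField S) K := .right (ResidueField R) _ _
  have : Algebra.IsSeparable (ResidueField S) K :=
    Algebra.isSeparable_tower_top_of_isSeparable (ResidueField R) _ _
  obtain ⟨T, _, _, _, φ, _, _, _, hφ, hmT, hφS⟩ := exists_etale_cover_of_residueField S K
  let : Algebra R T := ((algebraMap S T).comp (algebraMap R S)).toAlgebra
  have : IsScalarTower R S T := .of_algebraMap_eq fun _ => rfl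
  let : Algebra R K := ((algebraMap (ResidueField R) K).comp (residue R)).toAlgebra
  have : IsScalarTower R (ResidueField R) K := .of_algebraMap_eq fun _ => rfl
  have : Algebra.FormallyEtale R T := .comp R S T
  have : Module.Flat R T := .trans R S T
  have hlocT : IsLocalHom (algebraMap S T) :=
    (local_hom_TFAE (algebraMap S T)).out 2 0 rfl rfl |>.mp hmT.le
  have : IsLocalHom (algebraMap R T) := RingHom.isLocalHom_comp (algebraMap S T) (algebraMap R S)
  have : Module.FaithfullyFlat S T := .of_flat_of_isLocalHom
  have : Module.FaithfullyFlat R T := .of_flat_of_isLocalHom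
  have : IsNoetherianRing T := IsNoetherianRing.of_finite S T
  have hmRT : (maximalIdeal R).map (algebraMap R T) = maximalIdeal T := by
    rw [IsScalarTower.algebraMap_eq R S T, ← Ideal.map_map, hmS, hmT]
  set 𝔟 := 𝔞.map (algebraMap R T) with h𝔟
  have h𝔟' : 𝔟 = (𝔞.map (algebraMap R S)).map (algebraMap S T) := by
    rw [Ideal.map_map, h𝔟, IsScalarTower.algebraMap_eq R S T]
  have h𝔟m : 𝔟 ≤ maximalIdeal T := hmRT ▸ Ideal.map_mono h𝔞
  let C := T ⧸ 𝔟
  have : Nontrivial C := Ideal.Quotient.nontrivial_iff.mpr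
    (ne_top_of_le_ne_top (maximalIdeal.isMaximal T).ne_top h𝔟m)
  have hlocC : IsLocalRing C := .of_surjective' (Ideal.Quotient.mk 𝔟) Ideal.Quotient.mk_surjective
  let g : S →+* C := (Ideal.Quotient.mk 𝔟).comp (algebraMap S T)
  have hmC : (maximalIdeal T).map (Ideal.Quotient.mk 𝔟) = maximalIdeal C :=
    map_maximalIdeal_of_surjective _ Ideal.Quotient.mk_surjective
  have hgR : g.comp (algebraMap R S) = algebraMap R C := rfl
  have hgR' : g.comp (algebraMap R S) = (Ideal.Quotient.mk 𝔟).comp (algebraMap R T) := rfl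
  have hmRC : (maximalIdeal R).map (algebraMap R C) = maximalIdeal C := by
    rw [← hgR, hgR', ← Ideal.map_map, hmRT, hmC]
  have hnil : maximalIdeal C ^ N = ⊥ := by
    rw [← hmC, ← Ideal.map_pow, Ideal.map_eq_bot_iff_le_ker, Ideal.mk_ker, ← hmRT,
      ← Ideal.map_pow]
    exact Ideal.map_mono hN
  have hkerT : RingHom.ker φ = maximalIdeal T :=
    eq_maximalIdeal (RingHom.ker_isMaximal_of_surjective φ hφ)
  let ψ : C →ₐ[R] K :=
    { toRingHom := Ideal.Quotient.lift 𝔟 φ fun a ha => by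
        have := h𝔟m ha
        rwa [← hkerT] at this
      commutes' := fun r => by
        have := RingHom.congr_fun hφS (algebraMap R S r)
        refine this.trans ?_
        change algebraMap (ResidueField S) K (residue S (algebraMap R S r)) =
          algebraMap (ResidueField R) K (residue R r)
        rw [IsScalarTower.algebraMap_apply (ResidueField R) (ResidueField S) K]
        rfl }
  have hψ : Function.Surjective ψ := fun x => by
    obtain ⟨t, rfl⟩ := hφ x
    exact ⟨Ideal.Quotient.mk 𝔟 t, rfl⟩
  have hkerC : RingHom.ker ψ = maximalIdeal C :=
    eq_maximalIdeal (RingHom.ker_isMaximal_of_surjective ψ hψ)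
  have hnilψ : IsNilpotent (RingHom.ker ψ) := ⟨N, by rw [hkerC, hnil]; rfl⟩
  obtain ⟨L, hL⟩ := exists_lift_galois (k := ResidueField R) 𝔞 ψ hψ hnilψ
  refine ⟨C, inferInstance, hlocC, inferInstance, g, ?_, hnil, ?_, ?_, ?_⟩
  · rw [← Ideal.map_map, hmT, hmC]
  · exact fun J hJ => comap_map_quotient h𝔟 hJ
  · exact fun J hJ => comap_map_quotient h𝔟' hJ
  · intro J hJ
    rw [hgR] at hJ ⊢
    exact map_comap_eq_of_stable ψ residue_surjective L hψ hL (hkerC.trans hmRC.symm) hnilψ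
      fun σ x hx => hJ (L σ).toRingEquiv (RingHom.ext fun r => (L σ).commutes r) x hx

end GaloisCover

/-! ### Frobenius powers and slopes -/

lemma charP_of_ringHom {R : Type u} {S : Type v} [CommRing R] [CommRing S] (p : ℕ)
    [Fact p.Prime] [CharP R p] (f : R →+* S) [Nontrivial S] : CharP S p := by
  have h : (p : S) = 0 := by rw [← map_natCast f, CharP.cast_eq_zero, map_zero]
  exact (CharP.charP_iff_prime_eq_zero Fact.out).mpr h

section Frobenius

variable {R : Type u} {S : Type v} [CommRing R] [CommRing S] (p e : ℕ) [Fact p.Prime]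

lemma frobPower_le (I : Ideal R) : frobPower p e I ≤ I := by
  rw [frobPower, Ideal.span_le]
  rintro _ ⟨a, ha, rfl⟩
  exact Ideal.pow_mem_of_mem _ ha _ (pow_pos (Fact.out : p.Prime).pos e)

lemma radical_frobPower (I : Ideal R) : (frobPower p e I).radical = I.radical := by
  refine le_antisymm (Ideal.radical_mono (frobPower_le p e I)) ?_
  rw [Ideal.radical_le_radical_iff]
  exact fun a ha => ⟨p ^ e, Ideal.subset_span ⟨a, ha, rfl⟩⟩

variable [CharP R p] [CharP S p]

/-- The `p^e`-th powers of the elements of `I` are the images under the iterated Frobenius. -/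
lemma frobPower_eq_map (I : Ideal R) : frobPower p e I = I.map (iterateFrobenius R p e) := by
  rw [frobPower, Ideal.map]
  congr 1
  ext x
  simp [iterateFrobenius_def, eq_comm]

lemma frobPower_mono {I J : Ideal R} (h : I ≤ J) : frobPower p e I ≤ frobPower p e J := by
  rw [frobPower_eq_map, frobPower_eq_map]
  exact Ideal.map_mono h

lemma frobPower_sup (I J : Ideal R) :
    frobPower p e (I ⊔ J) = frobPower p e I ⊔ frobPower p e J := by
  simp only [frobPower_eq_map, Ideal.map_sup]

lemma frobPower_map (f : R →+* S) (I : Ideal R) :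
    frobPower p e (I.map f) = (frobPower p e I).map f := by
  rw [frobPower_eq_map, frobPower_eq_map, Ideal.map_map, Ideal.map_map]
  congr 1
  ext x
  simp [iterateFrobenius_def]

end Frobenius

lemma map_lt_map_and_mul_le {R : Type u} {C : Type v} [CommRing R] [CommRing C] {𝔪 : Ideal R}
    {𝔫 : Ideal C} (f : R →+* C) (hf : 𝔪.map f = 𝔫) {I₀ I : Ideal R}
    (h₀ : (I₀.map f).comap f = I₀) (hI : I₀ < I) (hm : 𝔪 * I ≤ I₀) :
    I₀.map f < I.map f ∧ 𝔫 * I.map f ≤ I₀.map f := by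
  refine ⟨lt_of_le_of_ne (Ideal.map_mono hI.le) fun h => ?_, ?_⟩
  · have : I ≤ (I₀.map f).comap f := h ▸ Ideal.le_comap_map
    exact hI.not_ge (h₀ ▸ this)
  · rw [← hf, ← Ideal.map_mul]
    exact Ideal.map_mono hm

section Final

variable {R : Type u} {C : Type v} [CommRing R] [IsLocalRing R] [IsNoetherianRing R]
  [CommRing C] [IsLocalRing C] (p e : ℕ) [Fact p.Prime] [CharP R p] [CharP C p]

/-- The truncated ratio of `I` is computed after extension to `C`, up to the normalization by the
dimension of `R`. -/
lemma truncRatio_eq_of_map (f : R →+* C)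
    (hf : (maximalIdeal R).map f = maximalIdeal C) {I₀ I : Ideal R}
    (hA : ∀ J, frobPower p e I₀ ≤ J → (J.map f).comap f = J) {N : ℕ}
    (hN : maximalIdeal R ^ N ≤ frobPower p e I₀) (hI : I₀ ≤ I) :
    truncRatio p e I₀ I =
      (relLength (frobPower p e (I₀.map f)) (frobPower p e (I.map f)) : ℝ) /
        relLength (I₀.map f) (I.map f) / (p : ℝ) ^ (e * dimNat R) := by
  rw [truncRatio, frobPower_map, frobPower_map]
  simp only [relLength_eq_toNat]
  rw [eLength_map f hf hA hN le_rfl (frobPower_mono p e hI),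
    eLength_map f hf hA hN (frobPower_le p e I₀) hI, mul_comm, div_div]

/-- Over a Noetherian local ring in which a power of the maximal ideal lies in `I₀^{[p^e]}`, there
is an ideal of minimal slope `l(I^{[p^e]} / I₀^{[p^e]}) / l(I / I₀)`, which is moreover stable under
every automorphism preserving `I₀`. -/
lemma exists_stable_minimal_ideal [IsNoetherianRing C] {I₀ : Ideal C} {N : ℕ}
    (hN : maximalIdeal C ^ N ≤ frobPower p e I₀) (hI₀ : I₀ ≠ ⊤) :
    ∃ I : Ideal C, I₀ < I ∧ maximalIdeal C * I ≤ I₀ ∧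
      (∀ J : Ideal C, I₀ < J → maximalIdeal C * J ≤ I₀ →
        (relLength (frobPower p e I₀) (frobPower p e I) : ℝ) / relLength I₀ I ≤
          (relLength (frobPower p e I₀) (frobPower p e J) : ℝ) / relLength I₀ J) ∧
      ∀ τ : C ≃+* C, I₀.map (τ : C →+* C) = I₀ → ∀ x ∈ I, τ x ∈ I := by
  let s : Set (Ideal C) := {J | I₀ ≤ J ∧ maximalIdeal C * J ≤ I₀}
  have hN₀ := hN.trans (frobPower_le p e I₀)
  let f : Ideal C → ℕ := fun J => relLength (frobPower p e I₀) (frobPower p e J)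
  let d : Ideal C → ℕ := fun J => relLength I₀ J
  have hf : ∀ J, I₀ ≤ J → (f J : ℕ∞) = eLength (frobPower p e I₀) (frobPower p e J) :=
    fun J hJ => ENat.natCast_toNat (eLength_ne_top hN (frobPower_mono p e hJ))
  have hd : ∀ J, I₀ ≤ J → (d J : ℕ∞) = eLength I₀ J :=
    fun J hJ => ENat.natCast_toNat (eLength_ne_top hN₀ hJ)
  obtain ⟨n₁, hn₁⟩ := ENat.ne_top_iff_exists.mp (eLength_ne_top hN (I := ⊤) le_top)
  obtain ⟨n₂, hn₂⟩ := ENat.ne_top_iff_exists.mp (eLength_ne_top hN₀ (I := ⊤) le_top)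
  have hsup : ∀ x ∈ s, ∀ y ∈ s, x ⊔ y ∈ s := fun x hx y hy =>
    ⟨hx.1.trans le_sup_left, by rw [Ideal.mul_sup]; exact sup_le hx.2 hy.2⟩
  have hinf : ∀ x ∈ s, ∀ y ∈ s, x ⊓ y ∈ s := fun x hx y hy =>
    ⟨le_inf hx.1 hy.1, (Ideal.mul_mono_right inf_le_left).trans hx.2⟩
  obtain ⟨I, hIs, hI, hmin, hgreat⟩ := exists_greatest_of_minimal_slope (s := s) (o := I₀)
    (f := f) (d := d) (N := max n₁ n₂) hsup hinf
    ⟨le_rfl, Ideal.mul_le_right⟩ (fun x hx => hx.1)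
    (by
      obtain ⟨x, -, hx, hm⟩ := exists_socle_element hN₀ hI₀.lt_top
      refine ⟨I₀ ⊔ Ideal.span {x}, ⟨le_sup_left, ?_⟩, by simpa using hx⟩
      rw [Ideal.mul_sup, mul_comm _ (Ideal.span {x}), sup_le_iff,
        Ideal.span_singleton_mul_le_iff]
      exact ⟨Ideal.mul_le_right, fun r hr => mul_comm r x ▸ hm r hr⟩)
    (fun x hx y hy => by
      rw [← ENat.natCast_le_natCast]
      push_cast
      rw [hf _ (hsup x hx y hy).1, hf _ (hinf x hx y hy).1, hf x hx.1, hf y hy.1,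
        ← eLength_sup_add_inf (frobPower_mono p e hx.1) (frobPower_mono p e hy.1),
        frobPower_sup]
      gcongr
      exact eLength_mono (frobPower_mono p e (hinf x hx y hy).1)
        (le_inf (frobPower_mono p e inf_le_left) (frobPower_mono p e inf_le_right)))
    (fun x hx y hy => by
      rw [← ENat.natCast_inj]
      push_cast
      rw [hd _ (hsup x hx y hy).1, hd _ (hinf x hx y hy).1, hd x hx.1, hd y hy.1,
        eLength_sup_add_inf hx.1 hy.1])
    (by simp [d, relLength_eq_toNat, eLength_self])
    (fun x hx y hy hxy => by
      rw [← ENat.natCast_lt_natCast, hd x hx.1, hd y hy.1, eLength_add hx.1 hxy.le]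
      simpa using (ENat.add_lt_add_iff_left (eLength_ne_top hN₀ hx.1)).mpr (eLength_pos hxy))
    (fun x hx => by
      rw [← ENat.natCast_le_natCast, hf x hx.1]
      exact (eLength_mono (frobPower_mono p e hx.1) le_top).trans
        (hn₁ ▸ ENat.natCast_le_natCast.mpr (le_max_left _ _)))
    (fun x hx => by
      rw [← ENat.natCast_le_natCast, hd x hx.1]
      exact (eLength_mono hx.1 le_top).trans (hn₂ ▸ ENat.natCast_le_natCast.mpr (le_max_right _ _)))
  refine ⟨I, hI, hIs.2, fun J hJ hm => hmin J ⟨hJ.le, hm⟩ hJ, fun τ hτ x hx => ?_⟩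
  have hτm : (maximalIdeal C).map (τ : C →+* C) = maximalIdeal C := map_ringEquiv_maximalIdeal τ
  have hcomap : ∀ J : Ideal C, frobPower p e I₀ ≤ J →
      (J.map (τ : C →+* C)).comap (τ : C →+* C) = J := fun J _ =>
    Ideal.comap_map_of_bijective _ τ.bijective
  have hfI : f (I.map (τ : C →+* C)) = f I := by
    have := eLength_map (τ : C →+* C) hτm hcomap hN le_rfl (frobPower_mono p e hI.le)
    simp only [f, relLength_eq_toNat]
    rw [← this, ← frobPower_map, ← frobPower_map, hτ]
  have hdI : d (I.map (τ : C →+* C)) = d I := by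
    have := eLength_map (τ : C →+* C) hτm hcomap hN (frobPower_le p e I₀) hI.le
    simp only [d, relLength_eq_toNat]
    rw [← this, hτ]
  refine hgreat _ ⟨hτ ▸ Ideal.map_mono hI.le, ?_⟩ hfI hdI (Ideal.mem_map_of_mem _ hx)
  have := Ideal.map_mono (f := (τ : C →+* C)) hIs.2
  rwa [Ideal.map_mul, hτm, hτ] at this

end Final

theorem corollary3p2 (p : ℕ) [Fact p.Prime]
    (R : Type u) (S : Type v) [CommRing R] [IsLocalRing R] [IsNoetherianRing R] [CharP R p]
    [CommRing S] [IsLocalRing S] [IsNoetherianRing S] [Algebra R S]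
    (hRS : IsEtaleLocal R S)
    (I₀ : Ideal R) (hprim : I₀.IsPrimary) (hrad : I₀.radical = IsLocalRing.maximalIdeal R)
    (e : ℕ) (he : 0 < e) :
    IsLeast (truncSet p e I₀) (truncInv p e I₀) ∧
      IsLeast (truncSet p e (I₀.map (algebraMap R S)))
        (truncInv p e (I₀.map (algebraMap R S))) ∧
      truncInv p e I₀ = truncInv p e (I₀.map (algebraMap R S)) := by
  have := hRS.1
  obtain ⟨_, _, _⟩ := hRS.formallyEtale_flat_essFiniteType
  have hmS : (maximalIdeal R).map (algebraMap R S) = maximalIdeal S :=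
    Algebra.FormallyUnramified.map_maximalIdeal
  have : Module.FaithfullyFlat R S := .of_flat_of_isLocalHom
  have hdim : dimNat R = dimNat S := dimNat_eq_of_flat hmS
  have : CharP S p := charP_of_ringHom p (algebraMap R S)
  have hI₀m : I₀ ≤ maximalIdeal R := hrad ▸ Ideal.le_radical
  obtain ⟨N, hN⟩ : ∃ N, maximalIdeal R ^ N ≤ frobPower p e I₀ := by
    have := Ideal.exists_radical_pow_le_of_fg (frobPower p e I₀) (IsNoetherian.noetherian _)
    rwa [radical_frobPower, hrad] at this
  obtain ⟨C, _, _, _, g, hgm, hnil, hcR, hcS, hdesc⟩ :=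
    exists_galois_cover hRS hN ((frobPower_le p e I₀).trans hI₀m)
  set f : R →+* C := g.comp (algebraMap R S) with hf
  set K₀ := I₀.map (algebraMap R S) with hK₀
  have hfm : (maximalIdeal R).map f = maximalIdeal C := by rw [hf, ← Ideal.map_map, hmS, hgm]
  have hK₀g : K₀.map g = I₀.map f := by rw [hK₀, Ideal.map_map]
  have : CharP C p := charP_of_ringHom p f
  rw [← frobPower_map] at hcS
  have hNS : maximalIdeal S ^ N ≤ frobPower p e K₀ := by
    rw [← hmS, ← Ideal.map_pow, hK₀, frobPower_map]
    exact Ideal.map_mono hN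
  obtain ⟨J, hJ, hJm, hmin, hstab⟩ := exists_stable_minimal_ideal p e (C := C) (I₀ := I₀.map f)
    (N := N) (hnil.trans_le bot_le)
    (ne_top_of_le_ne_top (maximalIdeal.isMaximal C).ne_top (hfm ▸ Ideal.map_mono hI₀m))
  have hJdesc := hdesc J fun τ hτ => hstab τ (by rw [Ideal.map_map, hτ])
  -- `J` is extended from `R`, namely from its contraction `I`, which attains both minima.
  set I := J.comap f
  have hcI₀ := hcR I₀ (frobPower_le p e I₀)
  have hI : I₀ < I := by
    refine lt_of_le_of_ne (Ideal.map_le_iff_le_comap.mp hJ.le) fun h => ?_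
    rw [← hJdesc, ← h] at hJ
    exact lt_irrefl _ hJ
  have hIm : maximalIdeal R * I ≤ I₀ := by
    rw [← hcI₀, ← Ideal.map_le_iff_le_comap, Ideal.map_mul, hfm, hJdesc]
    exact hJm
  have hcK₀ := hcS K₀ (frobPower_le p e K₀)
  obtain ⟨hIS, hISm⟩ := map_lt_map_and_mul_le (algebraMap R S) hmS
    (Ideal.comap_map_eq_self_of_faithfullyFlat I₀) hI hIm
  rw [← hK₀] at hIS hISm
  have hIg : (I.map (algebraMap R S)).map g = J := by rw [Ideal.map_map, ← hf, hJdesc]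
  have hR : IsLeast (truncSet p e I₀) (truncRatio p e I₀ I) := by
    refine ⟨⟨I, hIm, hI, rfl⟩, ?_⟩
    rintro _ ⟨I', hm', hI', rfl⟩
    obtain ⟨h1, h2⟩ := map_lt_map_and_mul_le f hfm hcI₀ hI' hm'
    rw [truncRatio_eq_of_map p e f hfm hcR hN hI.le, truncRatio_eq_of_map p e f hfm hcR hN hI'.le,
      hJdesc]
    exact div_le_div_of_nonneg_right (hmin _ h1 h2) (by positivity)
  have hS : IsLeast (truncSet p e K₀) (truncRatio p e K₀ (I.map (algebraMap R S))) := by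
    refine ⟨⟨_, hISm, hIS, rfl⟩, ?_⟩
    rintro _ ⟨I', hm', hI', rfl⟩
    obtain ⟨h1, h2⟩ := map_lt_map_and_mul_le g hgm hcK₀ hI' hm'
    rw [truncRatio_eq_of_map p e g hgm hcS hNS hIS.le,
      truncRatio_eq_of_map p e g hgm hcS hNS hI'.le, hIg]
    rw [hK₀g] at h1 h2 ⊢
    exact div_le_div_of_nonneg_right (hmin _ h1 h2) (by positivity)
  have heq : truncRatio p e I₀ I = truncRatio p e K₀ (I.map (algebraMap R S)) := by
    rw [truncRatio_eq_of_map p e f hfm hcR hN hI.le,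
      truncRatio_eq_of_map p e g hgm hcS hNS hIS.le, hJdesc, hIg, hK₀g, hdim]
  rw [truncInv, truncInv, hR.csInf_eq, hS.csInf_eq]
  exact ⟨hR, hS, heq⟩
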